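/- Let $n$ be an integer with $n\neq 0,-1$ and put $N=(|4n+1|-1)/2$. Let $$G_n=\langle \alpha,\beta \mid \alpha\,\omega^{n}=\omega^{n}\beta\rangle,\qquad \omega=\beta\alpha^{-1}\beta^{-1}\alpha,$$ be the group of the $n$-twist knot $K_n$ ($K_1$ is the figure-eight knot), with meridian $m=\alpha$ and preferred longitude $\ell=\omega^{n}\tilde\omega^{\,n}$, where $\tilde\omega=\alpha\beta^{-1}\alpha^{-1}\beta$ is $\omega$ read backwards. Let $\pi_1(M)=G_n/\langle\!\langle m^4\ell\rangle\!\rangle$ be the fundamental group of the manifold $M$ obtained by $4$-surgery along $K_n$. For $k=1,\dots,N$ let $\rho_k:G_n\to \mathrm{SL}_2(\mathbb C)$ be the representation with $$\rho_k(\alpha)=\begin{pmatrix} \sqrt{-1} & -\sqrt{-1}\\ 0&-\sqrt{-1}\end{pmatrix},\quad \rho_k(\beta)=\begin{pmatrix} \sqrt{-1} & 0\\ -u_k\sqrt{-1}&-\sqrt{-1}\end{pmatrix},\quad u_k=-4\sin^2\frac{k\pi}{4n+1};$$ it sends $m^4\ell$ to the identity and so induces $\bar\rho_k:\pi_1(M)\to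 \mathrm{SL}_2(\mathbb C)$. Each $\rho_k$ is irreducible and metabelian (it maps the commutator subgroup to an abelian group). Moreover, $\pi_1(M)$ is isomorphic to $$\langle a,b,x,y \mid a^2=b^{2n+1},\ x^{-1}yx=y^{-1},\ \mu=y^{-1},\ h=y^{-1}x^2\rangle,\qquad \mu=b^{-n}a,\quad h=a^2,$$ where $\mu$ is a meridian of the torus knot $T(2,2n+1)$. For every identification of $\pi_1(M)$ with this group by an isomorphism, the following holds. 1. The pairs of eigenvalues of the matrices $\bar\rho_k(\mu)$, $k=1,\dots,N$, are exactly the pairs $$\left\{e^{\pi(2j-1)\sqrt{-1}/|4n+1|},\ e^{-\pi(2j-1)\sqrt{-1}/|4n+1|}\right\},\qquad j=1,\dots,N;$$ that is, the set of the eigenvalue pairs of the $\bar\rho_k(\mu)$ equals the set of these pairs. 2. For every $k$, the order of $\bar\rho_k(\mu)$ is $2p_k$ for some divisor $p_k$ of $|4n+1|$. -/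

import Mathlib

open scoped Real Matrix

noncomputable section

namespace TwistKnot

/-! ### The group of the twist knot and its surgery quotient -/

/-- The two meridian generators of the twist knot group. -/
inductive KnotGen
  | alpha
  | beta

/-- The generator `α` in the free group. -/
def fα : FreeGroup KnotGen := FreeGroup.of KnotGen.alpha

/-- The generator `β` in the free group. -/
def fβ : FreeGroup KnotGen := FreeGroup.of KnotGen.beta

/-- The word `ω = β α⁻¹ β⁻¹ α`. -/
def fω : FreeGroup KnotGen := fβ * fα⁻¹ * fβ⁻¹ * fα

/-- The word `ω` read backwards, `α β⁻¹ α⁻¹ β`. -/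
def fωrev : FreeGroup KnotGen := fα * fβ⁻¹ * fα⁻¹ * fβ

/-- The group of the `n`-twist knot `K_n` (`K_1` is the figure-eight knot):
`⟨α, β ∣ α ω ^ n = ω ^ n β⟩`. -/
abbrev KnotGroup (n : ℤ) : Type :=
  PresentedGroup ({fα * fω ^ n * (fω ^ n * fβ)⁻¹} : Set (FreeGroup KnotGen))

/-- The class in the knot group of a word in `α`, `β`. -/
def word (n : ℤ) : FreeGroup KnotGen →* KnotGroup n :=
  PresentedGroup.mk _

/-- The meridian `m = α`. -/
def meridian (n : ℤ) : KnotGroup n := word n fα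

/-- The preferred longitude `ℓ = ω ^ n (ω read backwards) ^ n` commuting with `m = α`. -/
def longitude (n : ℤ) : KnotGroup n := word n (fω ^ n * fωrev ^ n)

/-- The quotient of the knot group by the normal closure of `m ^ 4 ℓ`:
the fundamental group of the manifold obtained by `4`-surgery along `K_n`. -/
abbrev SurgeryGroup (n : ℤ) : Type :=
  KnotGroup n ⧸ Subgroup.normalClosure ({meridian n ^ 4 * longitude n} : Set (KnotGroup n))

/-! ### The presentation coming from the torus decomposition -/

/-- The four generators `a, b` (torus knot exterior of type `(2, 2n+1)`) and
`x, y` (twisted `I`-bundle over the Klein bottle). -/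
inductive GraphGen
  | a
  | b
  | x
  | y

/-- The generator `a` in the free group. -/
def ga : FreeGroup GraphGen := FreeGroup.of GraphGen.a

/-- The generator `b` in the free group. -/
def gb : FreeGroup GraphGen := FreeGroup.of GraphGen.b

/-- The generator `x` in the free group. -/
def gx : FreeGroup GraphGen := FreeGroup.of GraphGen.x

/-- The generator `y` in the free group. -/
def gy : FreeGroup GraphGen := FreeGroup.of GraphGen.y

/-- The word `μ = b⁻ⁿ a` (a meridian of the torus knot). -/
def gμ (n : ℤ) : FreeGroup GraphGen := gb ^ (-n) * ga

/-- The word `h = a²` (a regular fibre of the torus knot exterior). -/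
def gh : FreeGroup GraphGen := ga ^ 2

/-- The relators of
`⟨a, b, x, y ∣ a² = b ^ (2n+1), x⁻¹ y x = y⁻¹, μ = y⁻¹, h = y⁻¹ x²⟩`. -/
def graphRels (n : ℤ) : Set (FreeGroup GraphGen) :=
  {ga ^ 2 * (gb ^ (2 * n + 1))⁻¹,
   gx⁻¹ * gy * gx * (gy⁻¹)⁻¹,
   gμ n * (gy⁻¹)⁻¹,
   gh * (gy⁻¹ * gx ^ 2)⁻¹}

/-- The group `⟨a, b, x, y ∣ a² = b ^ (2n+1), x⁻¹ y x = y⁻¹, μ = y⁻¹, h = y⁻¹ x²⟩`. -/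
abbrev GraphGroup (n : ℤ) : Type := PresentedGroup (graphRels n)

/-- The torus knot meridian `μ = b⁻ⁿ a` in the presented group. -/
def torusMeridian (n : ℤ) : GraphGroup n := PresentedGroup.mk (graphRels n) (gμ n)

/-! ### Representations into `SL(2, ℂ)` -/

/-- The group `SL(2, ℂ)`. -/
abbrev SL2C : Type := Matrix.SpecialLinearGroup (Fin 2) ℂ

/-- A representation is irreducible if the only invariant subspaces of `ℂ²` are `0` and `ℂ²`. -/
def IsIrreducibleRep {H : Type*} [Group H] (ρ : H →* SL2C) : Prop :=
  ∀ W : Submodule ℂ (Fin 2 → ℂ),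
    (∀ g : H, ∀ v ∈ W, (ρ g : Matrix (Fin 2) (Fin 2) ℂ) *ᵥ v ∈ W) → W = ⊥ ∨ W = ⊤

/-- A representation is metabelian if it sends the commutator subgroup to an abelian group. -/
def IsMetabelianRep {H : Type*} [Group H] (ρ : H →* SL2C) : Prop :=
  ∀ g ∈ commutator H, ∀ h ∈ commutator H, ρ g * ρ h = ρ h * ρ g

/-- The set of eigenvalues of an element of `SL(2, ℂ)` acting on `ℂ²`. -/
def eigenvalueSet (A : SL2C) : Set ℂ :=
  {ξ : ℂ | Module.End.HasEigenvalue (Matrix.toLin' (A : Matrix (Fin 2) (Fin 2) ℂ)) ξ}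

/-- The index range `1, …, (|4n+1| - 1) / 2`. -/
abbrev Index (n : ℤ) : Type := {k : ℕ // 1 ≤ k ∧ k ≤ ((4 * n + 1).natAbs - 1) / 2}

/-- `u_k = -4 sin² (k π / (4n+1))`. -/
def u (n : ℤ) (k : Index n) : ℝ :=
  -4 * Real.sin ((k.1 : ℝ) * π / (4 * (n : ℝ) + 1)) ^ 2

/-- The matrix `ρ_k(α)`. -/
def matA : SL2C :=
  ⟨!![Complex.I, -Complex.I; 0, -Complex.I], by simp [Matrix.det_fin_two]⟩

/-- The matrix `ρ_k(β)`. -/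
def matB (n : ℤ) (k : Index n) : SL2C :=
  ⟨!![Complex.I, 0; -(u n k : ℂ) * Complex.I, -Complex.I], by simp [Matrix.det_fin_two]⟩

/-- The assignment of matrices to the generators. -/
def genImage (n : ℤ) (k : Index n) : KnotGen → SL2C
  | KnotGen.alpha => matA
  | KnotGen.beta => matB n k

theorem matA_sq : matA * matA = -1 := by
  apply Subtype.ext
  rw [Matrix.SpecialLinearGroup.coe_mul]
  ext i j
  fin_cases i <;> fin_cases j <;> simp [matA, Matrix.mul_apply, Fin.sum_univ_two]

theorem matB_sq (n : ℤ) (k : Index n) : matB n k * matB n k = -1 := by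
  apply Subtype.ext
  rw [Matrix.SpecialLinearGroup.coe_mul]
  ext i j
  fin_cases i <;> fin_cases j <;> simp [matB, Matrix.mul_apply, Fin.sum_univ_two]
  ring

/-- Powers of a `2 × 2` matrix `E` with `E² = 2 cos φ E - 1`. -/
theorem pow_formula (E : Matrix (Fin 2) (Fin 2) ℂ) (φ : ℝ)
    (hE : E * E = (2 * Real.cos φ : ℂ) • E - 1) (j : ℕ) :
    (Real.sin φ : ℂ) • E ^ j =
      (Real.sin (j * φ) : ℂ) • E - (Real.sin ((j - 1) * φ) : ℂ) • (1 : Matrix (Fin 2) (Fin 2) ℂ) := by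
  induction j with
  | zero => simp
  | succ j ih =>
    have h1 : Real.sin ((j + 1) * φ) = 2 * Real.cos φ * Real.sin (j * φ) - Real.sin ((j - 1) * φ) := by
      rw [add_mul, sub_mul, one_mul, Real.sin_add, Real.sin_sub]; ring
    rw [pow_succ, ← smul_mul_assoc, ih, sub_mul, smul_mul_assoc, hE, smul_mul_assoc, one_mul]
    rw [show (((j + 1 : ℕ) : ℝ)) = (j : ℝ) + 1 by push_cast; rfl, h1,
      show ((j : ℝ) + 1 - 1) = j by ring]
    push_cast
    module

theorem C_zpow (n : ℤ) (k : Index n) : (matB n k * matA) ^ (4 * n + 1) = -1 := by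
  obtain ⟨k, hk1, hk2⟩ := k
  set K : Index n := ⟨k, hk1, hk2⟩ with hK
  set M : ℕ := (4 * n + 1).natAbs with hM
  have hM3 : 2 * k + 1 ≤ M := by omega
  have hMpos : (0 : ℝ) < M := by exact_mod_cast (by omega : 0 < M)
  have hodd : Odd M := by
    rw [hM, Int.natAbs_odd]; exact ⟨2 * n, by ring⟩
  set φ : ℝ := 2 * (k * π / M) with hφ
  have hMφ : (M : ℝ) * φ = (k : ℝ) * (2 * π) := by rw [hφ]; field_simp
  have hu : u n K = -2 + 2 * Real.cos φ := by
    have hs : Real.sin ((k : ℝ) * π / (4 * (n : ℝ) + 1)) ^ 2 = Real.sin (k * π / M) ^ 2 := by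
      have hMabs : (M : ℝ) = |4 * (n : ℝ) + 1| := by
        rw [hM, Nat.cast_natAbs]; push_cast; rfl
      rcases abs_choice (4 * (n : ℝ) + 1) with h | h
      · rw [hMabs, h]
      · rw [hMabs, h, div_neg, Real.sin_neg, neg_sq]
    simp only [u, hK, hs]
    rw [hφ, Real.cos_two_mul, Real.cos_sq']; ring
  have hsin : Real.sin φ ≠ 0 := by
    apply ne_of_gt
    apply Real.sin_pos_of_pos_of_lt_pi
    · have : (0 : ℝ) < k := by exact_mod_cast hk1
      positivity
    · rw [hφ, ← mul_div_assoc, div_lt_iff₀ hMpos]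
      have : (2 * k : ℝ) < M := by exact_mod_cast (by omega : 2 * k < M)
      nlinarith [Real.pi_pos]
  set E : SL2C := -(matB n K * matA) with hE
  have hE2 : (E : Matrix (Fin 2) (Fin 2) ℂ) * E = (2 * Real.cos φ : ℂ) • (E : Matrix (Fin 2) (Fin 2) ℂ) - 1 := by
    have huc : (u n K : ℂ) = -2 + 2 * (Real.cos φ : ℂ) := by rw [hu]; push_cast; ring
    have hval : (E : Matrix (Fin 2) (Fin 2) ℂ) = !![1, -1; -(u n K : ℂ), (u n K : ℂ) + 1] := by
      rw [hE, Matrix.SpecialLinearGroup.coe_neg, Matrix.SpecialLinearGroup.coe_mul]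
      ext i j
      fin_cases i <;> fin_cases j <;>
        simp [matA, matB, Matrix.mul_apply, Fin.sum_univ_two, mul_assoc]
      ring
    rw [hval, huc]
    ext i j
    fin_cases i <;> fin_cases j <;>
      simp [Matrix.mul_apply, Fin.sum_univ_two] <;> ring
  have hEM : (E : Matrix (Fin 2) (Fin 2) ℂ) ^ M = 1 := by
    have h := pow_formula (E : Matrix (Fin 2) (Fin 2) ℂ) φ hE2 M
    have h0 : Real.sin (M * φ) = 0 := by
      rw [hMφ, show (k : ℝ) * (2 * π) = ((2 * k : ℕ) : ℝ) * π by push_cast; ring]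
      exact Real.sin_nat_mul_pi _
    have h1 : Real.sin ((M - 1) * φ) = -Real.sin φ := by
      rw [sub_mul, one_mul, hMφ, Real.sin_nat_mul_two_pi_sub]
    rw [h0, h1] at h
    have hc : (Real.sin φ : ℂ) ≠ 0 := by exact_mod_cast hsin
    have h' : (Real.sin φ : ℂ) • (E : Matrix (Fin 2) (Fin 2) ℂ) ^ M = (Real.sin φ : ℂ) • 1 := by
      rw [h]; simp
    exact smul_right_injective _ hc h'
  have hEM' : E ^ M = 1 := by
    apply Subtype.ext; simpa using hEM
  have hCM : (matB n K * matA) ^ M = -1 := by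
    have : matB n K * matA = -E := by rw [hE, neg_neg]
    rw [this, hodd.neg_pow, hEM']
  rcases Int.natAbs_eq (4 * n + 1) with h | h
  · rw [h, zpow_natCast]; exact hCM
  · rw [h, zpow_neg, zpow_natCast, ← hM, hCM]
    exact inv_eq_of_mul_eq_one_left (by simp)

/-- Group identities behind the defining relation and the longitude. -/
theorem word_identities {H : Type*} [Group H] (A B z : H) (n : ℤ) (hz : ∀ g, z * g = g * z)
    (hzz : z * z = 1) (hA : A * A = z) (hB : B * B = z) (hC : (B * A) ^ (4 * n + 1) = z) :
    A * (B * A⁻¹ * B⁻¹ * A) ^ n = (B * A⁻¹ * B⁻¹ * A) ^ n * B ∧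
      A ^ 4 * ((B * A⁻¹ * B⁻¹ * A) ^ n * (A * B⁻¹ * A⁻¹ * B) ^ n) = 1 := by
  have hAi : A⁻¹ = z * A := by
    rw [inv_eq_iff_mul_eq_one, ← mul_assoc, ← hz, mul_assoc, hA, hzz]
  have hBi : B⁻¹ = z * B := by
    rw [inv_eq_iff_mul_eq_one, ← mul_assoc, ← hz, mul_assoc, hB, hzz]
  have hzi : z⁻¹ = z := inv_eq_of_mul_eq_one_left hzz
  have hCi : (B * A)⁻¹ = A * B := by
    rw [mul_inv_rev, hAi, hBi, mul_assoc, ← mul_assoc A, ← hz A, mul_assoc, ← mul_assoc, hzz,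
      one_mul]
  have hw : B * A⁻¹ * B⁻¹ * A = (B * A) ^ (2 : ℤ) := by
    rw [hAi, hBi, zpow_two, ← mul_assoc B, ← hz B]
    calc z * B * A * (z * B) * A = z * (B * A * z) * B * A := by simp only [mul_assoc]
      _ = z * (z * (B * A)) * B * A := by rw [hz (B * A)]
      _ = (z * z) * (B * A * (B * A)) := by simp only [mul_assoc]
      _ = _ := by rw [hzz, one_mul]
  have hw' : A * B⁻¹ * A⁻¹ * B = (B * A) ^ (-2 : ℤ) := by
    rw [show (-2 : ℤ) = -(2 : ℤ) by rfl, ← inv_zpow', hCi, hAi, hBi, zpow_two]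
    rw [← mul_assoc A, ← hz A]
    calc z * A * B * (z * A) * B = z * (A * B * z) * A * B := by simp only [mul_assoc]
      _ = z * (z * (A * B)) * A * B := by rw [hz (A * B)]
      _ = (z * z) * (A * B * (A * B)) := by simp only [mul_assoc]
      _ = _ := by rw [hzz, one_mul]
  have hconj : A * (B * A) * A⁻¹ = (B * A)⁻¹ := by rw [hCi]; group
  have hconjn : ∀ m : ℤ, A * (B * A) ^ m = (B * A) ^ (-m) * A := by
    intro m
    have := conj_zpow (i := m) (a := A) (b := B * A)
    rw [hconj, inv_zpow'] at this
    rw [this]; group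
  constructor
  · rw [hw, ← zpow_mul, hconjn]
    have hBe : B = (B * A) * (z * A) := by rw [← hAi]; group
    have hz1 : (B * A) ^ (2 * n) * (B * A) * z = (B * A) ^ (-(2 * n)) := by
      have e : (B * A) ^ (2 * n) * (B * A) = (B * A) ^ (-(2 * n)) * (B * A) ^ (4 * n + 1) := by
        rw [← zpow_add, ← zpow_add_one]; congr 1; ring
      rw [e, hC, mul_assoc, hzz, mul_one]
    calc (B * A) ^ (-(2 * n)) * A = (B * A) ^ (2 * n) * (B * A) * z * A := by rw [hz1]
      _ = (B * A) ^ (2 * n) * ((B * A) * (z * A)) := by simp only [mul_assoc]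
      _ = _ := by rw [← hBe]
  · rw [hw, hw', ← zpow_mul, ← zpow_mul, ← zpow_add]
    have : A ^ 4 = 1 := by
      rw [show 4 = 2 * 2 by rfl, pow_mul, pow_two A, hA, pow_two, hzz]
    rw [this, one_mul]
    rw [show 2 * n + -2 * n = 0 by ring, zpow_zero]

theorem rep_identities (n : ℤ) (k : Index n) :
    matA * (matB n k * matA⁻¹ * (matB n k)⁻¹ * matA) ^ n =
        (matB n k * matA⁻¹ * (matB n k)⁻¹ * matA) ^ n * matB n k ∧
      matA ^ 4 * ((matB n k * matA⁻¹ * (matB n k)⁻¹ * matA) ^ n *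
        (matA * (matB n k)⁻¹ * matA⁻¹ * matB n k) ^ n) = 1 :=
  word_identities matA (matB n k) (-1) n (by simp) (by simp) matA_sq (matB_sq n k) (C_zpow n k)

/-- The representation `ρ_k` of the knot group, `α ↦ matA`, `β ↦ matB n k`. -/
def rho (n : ℤ) (k : Index n) : KnotGroup n →* SL2C :=
  PresentedGroup.toGroup (f := genImage n k) (by
    intro r hr
    rw [Set.mem_singleton_iff] at hr
    subst hr
    simp only [fω, fα, fβ, map_mul, map_zpow, map_inv, FreeGroup.lift_apply_of, genImage]
    rw [(rep_identities n k).1]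
    group)

theorem rho_surgery (n : ℤ) (k : Index n) : rho n k (meridian n ^ 4 * longitude n) = 1 := by
  have hα : rho n k (word n fα) = matA := PresentedGroup.toGroup.of _
  have hβ : rho n k (word n fβ) = matB n k := PresentedGroup.toGroup.of _
  simp only [meridian, longitude, fω, fωrev, map_mul, map_pow, map_zpow, map_inv, hα, hβ]
  exact (rep_identities n k).2

/-- The induced representation `ρ̄_k` of the surgery quotient. -/
def rhoBar (n : ℤ) (k : Index n) : SurgeryGroup n →* SL2C :=
  QuotientGroup.lift _ (rho n k) (by
    have h : Subgroup.normalClosure ({meridian n ^ 4 * longitude n} : Set (KnotGroup n)) ≤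
        (rho n k).ker :=
      Subgroup.normalClosure_le_normal (by
        rw [Set.singleton_subset_iff]; exact rho_surgery n k)
    exact h)

end TwistKnot

end

/-! The isomorphism is explicit: `b = ω`, `x = α ω^n`, `a = α ω^n α`, `y = (β α)⁻¹`, with inverse `α
= x⁻¹ a`, `β = b^(-n) x`. Given the knot relation, `m^4 ℓ` is conjugate to `a b^(-(2n+1)) a`, so the
surgery relation is exactly the torus knot relation (`surgery_relation_iff`).

The eigenvalue statement concerns every identification, so it cannot be read off from this one.
Instead all `ρ̄_k` and the homology class in ℤ/4 are collected into one homomorphism. Its image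
consists of the products `E^i A^j`, where `E` is the image of `β α⁻¹`, of order `|4n+1|`, and `A` is
the image of `α`, of order four and inverting `E`. A homomorphism of the graph group onto this image
is rigid enough to determine the form of `μ` (`exists_map_torusMeridian`). The relations force `b`
to have homology class 0, so `b` goes to a power of `E`. Surjectivity forces `x` to have odd class,
so `x` inverts `E` and has square `A²`. Hence `μ = y⁻¹ = a² x⁻²` goes to `b^(2n+1) A²`. Surjectivity
also makes the image of `b` a generator of the powers of `E`, and `2n+1` is inverse to 2 modulo
`4n+1`; so `μ` goes to `A² E^l` with `l` a unit.

In SL₂ the square of `A` is `-1`, so `ρ̄_k(μ) = -E_k^l` with the same `l` for all `k`. Since `E_k`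
has trace `2 cos(2kπ/(4n+1))`, the eigenvalues are `exp(±i(π - 2lkπ/(4n+1)))`. Multiplication by `l`
permutes the nonzero residues up to sign, which gives the listed pairs. As `E_k^l` has odd order,
`-E_k^l` has twice that order. -/

namespace TwistKnot

/-! ### The isomorphism between the two presentations -/

section Isomorphism

variable {H : Type*} [Group H]

/-- Modulo the knot group relation, the relation of `4`-surgery is equivalent to the torus knot
relation between `α ω ^ n α` and `ω`. -/
theorem surgery_relation_iff (A B : H) (n : ℤ)
    (h : A * (B * A⁻¹ * B⁻¹ * A) ^ n = (B * A⁻¹ * B⁻¹ * A) ^ n * B) :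
    A ^ 4 * ((B * A⁻¹ * B⁻¹ * A) ^ n * (A * B⁻¹ * A⁻¹ * B) ^ n) = 1 ↔
      (A * (B * A⁻¹ * B⁻¹ * A) ^ n * A) ^ 2 = (B * A⁻¹ * B⁻¹ * A) ^ (2 * n + 1) := by
  have hrev : (A * B⁻¹ * A⁻¹ * B) ^ n =
      B⁻¹ * A * (B * A⁻¹ * B⁻¹ * A) ^ (-n) * (A⁻¹ * B) := by
    have e : A * B⁻¹ * A⁻¹ * B = (B⁻¹ * A) * (B * A⁻¹ * B⁻¹ * A)⁻¹ * (B⁻¹ * A)⁻¹ := by group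
    rw [e, conj_zpow, inv_zpow']
    group
  -- Besides `hrev`, this is all that is kept of the definition of `ω` before it becomes a generic
  -- `W`.
  have hd : A⁻¹ * B * A = (B * A⁻¹ * B⁻¹ * A)⁻¹ * B := by group
  rw [hrev]
  clear hrev
  generalize B * A⁻¹ * B⁻¹ * A = W at *
  have hB : B = W ^ (-n) * A * W ^ n := by
    rw [mul_assoc, h, ← mul_assoc, ← zpow_add, neg_add_cancel, zpow_zero, one_mul]
  have hd' : A⁻¹ * B = W⁻¹ * W ^ (-n) * A * W ^ n * A⁻¹ := by
    rw [eq_mul_inv_iff_mul_eq, hd, hB]; group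
  -- The surgery word is the conjugate by `A²` of `a c⁻¹ a`, with `a = A W^n A` and `c = W^(2n+1)`;
  -- it is trivial exactly when `a² = c`.
  have key : A ^ 4 * (W ^ n * (B⁻¹ * A * W ^ (-n) * (A⁻¹ * B))) =
      (A * A) * ((A * W ^ n * A) * (W ^ (2 * n + 1))⁻¹ * (A * W ^ n * A)) * (A * A)⁻¹ := by
    rw [hd', hB, show 2 * n + 1 = n + (1 + n) by ring, zpow_add, zpow_add,
      show A ^ 4 = A * A * A * A by simp only [pow_succ, pow_zero, one_mul]]
    group
  rw [key, conj_eq_one_iff]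
  generalize A * W ^ n * A = a
  generalize W ^ (2 * n + 1) = c
  constructor
  · intro e
    have e' : c⁻¹ = a⁻¹ * a⁻¹ := by
      calc c⁻¹ = a⁻¹ * (a * c⁻¹ * a) * a⁻¹ := by group
        _ = _ := by rw [e]; group
    rw [← inv_inv c, e']; group
  · rintro rfl
    group

/-- The torus knot group and Klein bottle group relations among words in the meridians. -/
theorem graph_relations (A B : H) (n : ℤ)
    (h : A * (B * A⁻¹ * B⁻¹ * A) ^ n = (B * A⁻¹ * B⁻¹ * A) ^ n * B)
    (hs : A ^ 4 * ((B * A⁻¹ * B⁻¹ * A) ^ n * (A * B⁻¹ * A⁻¹ * B) ^ n) = 1) :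
    (A * (B * A⁻¹ * B⁻¹ * A) ^ n * A) ^ 2 = (B * A⁻¹ * B⁻¹ * A) ^ (2 * n + 1) ∧
    (A * (B * A⁻¹ * B⁻¹ * A) ^ n)⁻¹ * (B * A)⁻¹ * (A * (B * A⁻¹ * B⁻¹ * A) ^ n) =
      (B * A)⁻¹⁻¹ ∧
    (B * A⁻¹ * B⁻¹ * A) ^ (-n) * (A * (B * A⁻¹ * B⁻¹ * A) ^ n * A) = (B * A)⁻¹⁻¹ ∧
    (A * (B * A⁻¹ * B⁻¹ * A) ^ n * A) ^ 2 =
      (B * A)⁻¹⁻¹ * (A * (B * A⁻¹ * B⁻¹ * A) ^ n) ^ 2 := by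
  have ht := (surgery_relation_iff A B n h).1 hs
  have hd : B * A * A⁻¹ * A⁻¹ * B⁻¹ * A = B * A⁻¹ * B⁻¹ * A := by group
  generalize B * A⁻¹ * B⁻¹ * A = W at *
  have hB : B = W ^ (-n) * A * W ^ n := by
    rw [mul_assoc, h, ← mul_assoc, ← zpow_add, neg_add_cancel, zpow_zero, one_mul]
  refine ⟨ht, ?_, ?_, ?_⟩
  -- The torus knot relation factors `W` through `B * A`. Comparing with the factorization `hd` that
  -- comes from the definition of `ω` yields the Klein bottle relation.
  · have e : (B * A) * (A * W ^ n * A * W ^ (-n)) = W := by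
      calc (B * A) * (A * W ^ n * A * W ^ (-n))
          = W ^ (-n) * (A * W ^ n * A) ^ 2 * W ^ (-n) := by rw [hB, pow_two]; group
        _ = W := by rw [ht]; group
    have hx : A * W ^ n * (B * A) * (A * W ^ n)⁻¹ = (B * A)⁻¹ := by
      calc A * W ^ n * (B * A) * (A * W ^ n)⁻¹
          = A * ((B * A)⁻¹ * ((B * A) * (A * W ^ n * A * W ^ (-n)))) * A⁻¹ := by
            rw [show A * W ^ n * (B * A) = A * (W ^ n * B) * A by group, ← h]; group
        _ = A * ((B * A)⁻¹ * (B * A * A⁻¹ * A⁻¹ * B⁻¹ * A)) * A⁻¹ := by rw [e, hd]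
        _ = _ := by group
    generalize A * W ^ n = x at *
    calc x⁻¹ * (B * A)⁻¹ * x = x⁻¹ * (x * (B * A) * x⁻¹) * x := by rw [hx]
      _ = _ := by group
  · rw [hB]; group
  -- The fibre `a²` is a power of `W`, hence commutes with `W^n`.
  · have hc : W ^ n * (A * W ^ n * A) ^ 2 = (A * W ^ n * A) ^ 2 * W ^ n := by
      rw [ht]; group
    rw [inv_inv, hB]
    have e : W ^ (-n) * A * W ^ n * A * (A * W ^ n) ^ 2 =
        W ^ (-n) * ((A * W ^ n * A) ^ 2 * W ^ n) := by simp only [pow_two]; group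
    rw [e, ← hc]; group

/-- The knot group relation and the surgery relation in terms of the generators of the graph
manifold group. -/
theorem knot_relations (a b x y : H) (n : ℤ) (h1 : a ^ 2 = b ^ (2 * n + 1))
    (h2 : x⁻¹ * y * x = y⁻¹) (h3 : b ^ (-n) * a = y⁻¹) (h4 : a ^ 2 = y⁻¹ * x ^ 2) :
    x⁻¹ * a = x * b ^ (-n) ∧
    b ^ (-n) * x * (x⁻¹ * a)⁻¹ * (b ^ (-n) * x)⁻¹ * (x⁻¹ * a) = b := by
  have ha : a = b ^ n * y⁻¹ := by rw [← h3]; group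
  have hy : y = a⁻¹ * b ^ n := by rw [ha]; group
  have hxx : x ^ 2 = a * b ^ n := by
    have e : x ^ 2 = y * a ^ 2 := by rw [h4]; group
    have hc : b ^ n * a ^ 2 = a ^ 2 * b ^ n := by rw [h1]; group
    rw [e, hy, mul_assoc, hc]; group
  have hα : x⁻¹ * a = x * b ^ (-n) := by
    have : a = x ^ 2 * b ^ (-n) := by rw [hxx]; group
    rw [this]; group
  refine ⟨hα, ?_⟩
  have hyx : x * y = y⁻¹ * x := by
    have e : y = x * y⁻¹ * x⁻¹ := by rw [← h2]; group
    calc x * y = (x * y⁻¹ * x⁻¹)⁻¹ * x := by group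
      _ = _ := by rw [← e]
  calc b ^ (-n) * x * (x⁻¹ * a)⁻¹ * (b ^ (-n) * x)⁻¹ * (x⁻¹ * a)
      = b ^ (-n) * x * (x * b ^ (-n))⁻¹ * (b ^ (-n) * x)⁻¹ * (x * b ^ (-n)) := by rw [hα]
    _ = b ^ (-n) * x * (b ^ n * (x ^ 2)⁻¹ * b ^ n) * x * b ^ (-n) := by group
    _ = b ^ (-n) * (x * y) * x * b ^ (-n) := by rw [hxx, hy]; group
    _ = b ^ (-n) * (y⁻¹ * x ^ 2) * b ^ (-n) := by rw [hyx, pow_two]; group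
    _ = b := by rw [← h4, h1]; group

end Isomorphism

/-! ### Universal properties of the two presentations, and the isomorphism -/

section Presentations

variable (n : ℤ)

theorem word_relation : word n fα * word n fω ^ n = word n fω ^ n * word n fβ := by
  have h : word n (fα * fω ^ n * (fω ^ n * fβ)⁻¹) = 1 :=
    (QuotientGroup.eq_one_iff _).2 (Subgroup.subset_normalClosure rfl)
  simpa only [map_mul, map_inv, map_zpow, mul_inv_eq_one] using h

/-- The class of `α` in the surgery group. -/
def sα : SurgeryGroup n := QuotientGroup.mk (word n fα)

/-- The class of `β` in the surgery group. -/
def sβ : SurgeryGroup n := QuotientGroup.mk (word n fβ)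

theorem surgery_knot_relation :
    sα n * (sβ n * (sα n)⁻¹ * (sβ n)⁻¹ * sα n) ^ n =
      (sβ n * (sα n)⁻¹ * (sβ n)⁻¹ * sα n) ^ n * sβ n :=
  congrArg (QuotientGroup.mk' _) (word_relation n)

theorem surgery_relation :
    sα n ^ 4 * ((sβ n * (sα n)⁻¹ * (sβ n)⁻¹ * sα n) ^ n *
      (sα n * (sβ n)⁻¹ * (sα n)⁻¹ * sβ n) ^ n) = 1 :=
  (QuotientGroup.eq_one_iff (meridian n ^ 4 * longitude n)).2 (Subgroup.subset_normalClosure rfl)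

theorem SurgeryGroup.hom_ext {H : Type*} [Group H] {f g : SurgeryGroup n →* H}
    (hα : f (sα n) = g (sα n)) (hβ : f (sβ n) = g (sβ n)) : f = g := by
  apply QuotientGroup.monoidHom_ext
  apply PresentedGroup.ext
  rintro (_ | _)
  exacts [hα, hβ]

/-- A homomorphism out of the surgery group, given by the images of `α` and `β`. -/
theorem SurgeryGroup.exists_hom {H : Type*} [Group H] (A B : H)
    (h : A * (B * A⁻¹ * B⁻¹ * A) ^ n = (B * A⁻¹ * B⁻¹ * A) ^ n * B)
    (hs : A ^ 4 * ((B * A⁻¹ * B⁻¹ * A) ^ n * (A * B⁻¹ * A⁻¹ * B) ^ n) = 1) :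
    ∃ f : SurgeryGroup n →* H, f (sα n) = A ∧ f (sβ n) = B := by
  let g : KnotGen → H := fun | .alpha => A | .beta => B
  have hA : FreeGroup.lift g fα = A := FreeGroup.lift_apply_of
  have hB : FreeGroup.lift g fβ = B := FreeGroup.lift_apply_of
  let f₀ : KnotGroup n →* H := PresentedGroup.toGroup (f := g) (by
    rintro r rfl
    simp only [fω, map_mul, map_inv, map_zpow, hA, hB]
    rw [h, mul_inv_cancel])
  have hA' : f₀ (word n fα) = A := PresentedGroup.toGroup.of _
  have hB' : f₀ (word n fβ) = B := PresentedGroup.toGroup.of _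
  refine ⟨QuotientGroup.lift _ f₀ ?_, hA', hB'⟩
  apply Subgroup.normalClosure_le_normal
  rw [Set.singleton_subset_iff]
  change f₀ (meridian n ^ 4 * longitude n) = 1
  simp only [meridian, longitude, fω, fωrev, map_mul, map_pow, map_zpow, map_inv, hA', hB']
  exact hs

/-- The class of a generator in the graph manifold group. -/
def gen (i : GraphGen) : GraphGroup n := PresentedGroup.of i

theorem graphGroup_relations :
    gen n .a ^ 2 = gen n .b ^ (2 * n + 1) ∧
    (gen n .x)⁻¹ * gen n .y * gen n .x = (gen n .y)⁻¹ ∧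
    gen n .b ^ (-n) * gen n .a = (gen n .y)⁻¹ ∧
    gen n .a ^ 2 = (gen n .y)⁻¹ * gen n .x ^ 2 := by
  have h : ∀ v w, v * w⁻¹ ∈ graphRels n →
      PresentedGroup.mk (graphRels n) v = PresentedGroup.mk (graphRels n) w := fun v w hr => by
    rw [← mul_inv_eq_one, ← map_inv, ← map_mul]
    exact PresentedGroup.one_of_mem hr
  exact ⟨h (ga ^ 2) (gb ^ (2 * n + 1)) (by simp [graphRels]),
    h (gx⁻¹ * gy * gx) gy⁻¹ (by simp [graphRels]), h (gμ n) gy⁻¹ (by simp [graphRels]),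
    h gh (gy⁻¹ * gx ^ 2) (by simp [graphRels])⟩

/-- A homomorphism out of the graph manifold group, given by the images of the generators. -/
theorem GraphGroup.exists_hom {H : Type*} [Group H] (a b x y : H) (h1 : a ^ 2 = b ^ (2 * n + 1))
    (h2 : x⁻¹ * y * x = y⁻¹) (h3 : b ^ (-n) * a = y⁻¹) (h4 : a ^ 2 = y⁻¹ * x ^ 2) :
    ∃ f : GraphGroup n →* H,
      f (gen n .a) = a ∧ f (gen n .b) = b ∧ f (gen n .x) = x ∧ f (gen n .y) = y := by
  let g : GraphGen → H := fun | .a => a | .b => b | .x => x | .y => y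
  have ha : FreeGroup.lift g ga = a := FreeGroup.lift_apply_of
  have hb : FreeGroup.lift g gb = b := FreeGroup.lift_apply_of
  have hx : FreeGroup.lift g gx = x := FreeGroup.lift_apply_of
  have hy : FreeGroup.lift g gy = y := FreeGroup.lift_apply_of
  refine ⟨PresentedGroup.toGroup (f := g) ?_, PresentedGroup.toGroup.of _,
    PresentedGroup.toGroup.of _, PresentedGroup.toGroup.of _, PresentedGroup.toGroup.of _⟩
  simp only [graphRels, Set.mem_insert_iff, Set.mem_singleton_iff, forall_eq_or_imp,
    forall_eq, gμ, gh, map_mul, map_inv, map_zpow, map_pow, mul_inv_eq_one, ha, hb, hx, hy]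
  exact ⟨h1, h2, h3, h4⟩

theorem nonempty_graphGroup_mulEquiv_surgeryGroup :
    Nonempty (GraphGroup n ≃* SurgeryGroup n) := by
  have hk := surgery_knot_relation n
  have hs := surgery_relation n
  obtain ⟨r1, r2, r3, r4⟩ := graph_relations _ _ n hk hs
  obtain ⟨f, fa, fb, fx, fy⟩ := GraphGroup.exists_hom n _ _ _ _ r1 r2 r3 r4
  obtain ⟨g1, g2, g3, g4⟩ := graphGroup_relations n
  obtain ⟨q1, q2⟩ := knot_relations _ _ _ _ n g1 g2 g3 g4
  have hkn : ((gen n .x)⁻¹ * gen n .a) * gen n .b ^ n =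
      gen n .b ^ n * (gen n .b ^ (-n) * gen n .x) := by
    rw [q1]; group
  have hax : gen n .x * ((gen n .x)⁻¹ * gen n .a) = gen n .a := by group
  have hx : ((gen n .x)⁻¹ * gen n .a) * gen n .b ^ n = gen n .x := by rw [q1]; group
  obtain ⟨g, gα, gβ⟩ := SurgeryGroup.exists_hom n ((gen n .x)⁻¹ * gen n .a)
    (gen n .b ^ (-n) * gen n .x) (by rw [q2]; exact hkn)
    ((surgery_relation_iff _ _ n (by rw [q2]; exact hkn)).2 (by rw [q2, hx, hax]; exact g1))
  refine ⟨MonoidHom.toMulEquiv f g ?_ ?_⟩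
  · apply PresentedGroup.ext
    rintro (_ | _ | _ | _)
    · change g (f (gen n .a)) = gen n .a
      simp only [fa, map_mul, map_inv, map_zpow, gα, gβ]
      rw [q2, hx, hax]
    · change g (f (gen n .b)) = gen n .b
      simp only [fb, map_mul, map_inv, gα, gβ]
      rw [q2]
    · change g (f (gen n .x)) = gen n .x
      simp only [fx, map_mul, map_inv, map_zpow, gα, gβ]
      rw [q2, hx]
    · change g (f (gen n .y)) = gen n .y
      simp only [fy, map_mul, map_inv, gα, gβ]
      rw [← inv_inj, ← g3]; group
  · apply SurgeryGroup.hom_ext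
    · change f (g (sα n)) = sα n
      simp only [gα, map_mul, map_inv, fa, fx]
      group
    · change f (g (sβ n)) = sβ n
      simp only [gβ, map_mul, map_zpow, fb, fx]
      rw [hk, ← mul_assoc, ← zpow_add, neg_add_cancel, zpow_zero, one_mul]

end Presentations

/-! ### Images in a group generated by two elements, one inverting the other -/

section Inverting

variable {H : Type*} [Group H]

theorem conj_zpow_eq_inv {A E : H} (h : A * E * A⁻¹ = E⁻¹) (i : ℤ) :
    A * E ^ i = E ^ (-i) * A := by
  rw [← mul_inv_eq_iff_eq_mul, ← conj_zpow, h, inv_zpow']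

theorem exists_zpow_mul_zpow {A E : H} (h : A * E * A⁻¹ = E⁻¹) (j : ℤ) :
    ∀ i : ℤ, ∃ i' : ℤ, A ^ j * E ^ i = E ^ i' * A ^ j := by
  induction j with
  | zero => exact fun i => ⟨i, by simp⟩
  | succ j ih =>
    intro i
    obtain ⟨i', h'⟩ := ih (-i)
    exact ⟨i', by rw [zpow_add_one, mul_assoc, conj_zpow_eq_inv h, ← mul_assoc, h', mul_assoc]⟩
  | pred j ih =>
    intro i
    obtain ⟨i', h'⟩ := ih (-i)
    refine ⟨i', ?_⟩
    have e : A⁻¹ * E ^ i = E ^ (-i) * A⁻¹ := by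
      rw [eq_mul_inv_iff_mul_eq, mul_assoc, inv_mul_eq_iff_eq_mul, conj_zpow_eq_inv h, neg_neg]
    rw [zpow_sub_one, mul_assoc, e, ← mul_assoc, h', mul_assoc]

/-- The subgroup of the products `E ^ i * A ^ j` when `A` inverts `E` by conjugation. -/
def invertingProduct {A E : H} (h : A * E * A⁻¹ = E⁻¹) : Subgroup H where
  carrier := {g | ∃ i j : ℤ, g = E ^ i * A ^ j}
  one_mem' := ⟨0, 0, by simp⟩
  mul_mem' := by
    rintro _ _ ⟨i, j, rfl⟩ ⟨i', j', rfl⟩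
    obtain ⟨l, hl⟩ := exists_zpow_mul_zpow h j i'
    exact ⟨i + l, j + j', by
      rw [zpow_add, zpow_add, mul_assoc, ← mul_assoc (A ^ j), hl]; group⟩
  inv_mem' := by
    rintro _ ⟨i, j, rfl⟩
    obtain ⟨l, hl⟩ := exists_zpow_mul_zpow h (-j) (-i)
    exact ⟨l, -j, by rw [← hl]; group⟩

theorem left_mem_invertingProduct {A E : H} (h : A * E * A⁻¹ = E⁻¹) : E ∈ invertingProduct h :=
  ⟨1, 0, by simp⟩

theorem right_mem_invertingProduct {A E : H} (h : A * E * A⁻¹ = E⁻¹) : A ∈ invertingProduct h :=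
  ⟨0, 1, by simp⟩

theorem zpow_eq_zpow_of_pow_four {A : H} (hA : A ^ 4 = 1) {i j : ℤ}
    (h : (i : ZMod 4) = (j : ZMod 4)) : A ^ i = A ^ j := by
  obtain ⟨c, hc⟩ := (ZMod.intCast_eq_intCast_iff_dvd_sub i j 4).1 h
  rw [show j = i + (4 : ℕ) * c by push_cast at hc ⊢; linarith, zpow_add, zpow_mul, zpow_natCast, hA,
    one_zpow, mul_one]

end Inverting

/-! ### Homology modulo four and the image of the torus knot meridian -/

/-- Doubling `a = n b - y` and using `2 y = 0` gives `2 a = 2 n b`; against `2 a = (2 n + 1) b` this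
leaves `b = 0`, and then `2 a = 0`. -/
theorem homology_relations : ∀ n a b x y : ZMod 4, 2 * a = (2 * n + 1) * b → 2 * y = 0 →
    -n * b + a = -y → 2 * a = -y + 2 * x → b = 0 ∧ (2 * x = 0 → 2 * a = 0) := by
  decide

theorem homology_x_unit : ∀ x : ZMod 4, 2 * x ≠ 0 → (x = 1 ∨ x = -1) := by
  decide

theorem homology_x_torsion : ∀ x j : ZMod 4, 2 * x ≠ 0 → 0 = j * x → j = 0 := by
  decide

/-- A homomorphism from the graph manifold group onto a group generated by `E` of order `|4n+1|`
and `A` of order four inverting `E`: the torus knot meridian goes to `A ^ 2` times a generator of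
the group of powers of `E`. -/
theorem exists_map_torusMeridian {H : Type*} [Group H] {E A : H} (n : ℤ)
    (hAE : A * E * A⁻¹ = E⁻¹) (hA : A ^ 4 = 1)
    (hord : ∀ s : ℤ, E ^ s = 1 → (4 * n + 1) ∣ s)
    (ε : H →* Multiplicative (ZMod 4)) (hεE : ε E = 1) (hεA : ε A = Multiplicative.ofAdd 1)
    (R : GraphGroup n →* H) (hR : ∀ g, R g ∈ invertingProduct hAE)
    (hRA : A ∈ R.range) (hRE : E ∈ R.range) :
    ∃ l i : ℤ, R (torusMeridian n) = A ^ 2 * E ^ l ∧ (4 * n + 1) ∣ l * i - 1 := by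
  obtain ⟨g1, g2, g3, g4⟩ := graphGroup_relations n
  replace g1 := congrArg R g1
  replace g2 := congrArg R g2
  replace g3 := congrArg R g3
  replace g4 := congrArg R g4
  simp only [map_mul, map_inv, map_pow, map_zpow] at g1 g2 g3 g4
  have hμ : R (torusMeridian n) = R (gen n .b) ^ (-n) * R (gen n .a) := by
    rw [← map_zpow, ← map_mul]; rfl
  have hε : ∀ i j : ℤ, (ε (E ^ i * A ^ j)).toAdd = (j : ZMod 4) := by
    intro i j
    simp [hεE, hεA]
  have ε1 := congrArg (fun g => (ε g).toAdd) g1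
  have ε2 := congrArg (fun g => (ε g).toAdd) g2
  have ε3 := congrArg (fun g => (ε g).toAdd) g3
  have ε4 := congrArg (fun g => (ε g).toAdd) g4
  simp only [map_mul, map_inv, map_pow, map_zpow, toAdd_mul, toAdd_inv, toAdd_pow, toAdd_zpow,
    nsmul_eq_mul, zsmul_eq_mul] at ε1 ε2 ε3 ε4
  push_cast at ε1 ε2 ε3 ε4
  have ε2' : 2 * (ε (R (gen n .y))).toAdd = 0 := by linear_combination ε2
  obtain ⟨hb0, hax⟩ := homology_relations _ _ _ _ _ ε1 ε2' ε3 ε4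
  obtain ⟨ib, jb, hb⟩ := hR (gen n .b)
  obtain ⟨ix, jx, hx⟩ := hR (gen n .x)
  have hbE : R (gen n .b) = E ^ ib := by
    rw [hb, hε] at hb0
    rw [hb, zpow_eq_zpow_of_pow_four hA (j := 0) (by simpa using hb0), zpow_zero, mul_one]
  -- Otherwise every generator would have homology class killed by 2, whereas `A`, of class 1 in
  -- ℤ/4, lies in the range.
  have hx2 : 2 * (ε (R (gen n .x))).toAdd ≠ 0 := by
    intro h0
    have hker : (ε.comp R) ^ 2 = 1 := by
      apply PresentedGroup.ext
      rintro (_ | _ | _ | _) <;> apply Multiplicative.toAdd.injective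
      · change (2 : ℕ) • (ε (R (gen n .a))).toAdd = 0
        rw [nsmul_eq_mul]; exact hax h0
      · change (2 : ℕ) • (ε (R (gen n .b))).toAdd = 0
        rw [hb0, smul_zero]
      · change (2 : ℕ) • (ε (R (gen n .x))).toAdd = 0
        rw [nsmul_eq_mul]; exact h0
      · change (2 : ℕ) • (ε (R (gen n .y))).toAdd = 0
        rw [nsmul_eq_mul]; exact ε2'
    obtain ⟨g, hg⟩ := hRA
    have h := DFunLike.congr_fun hker g
    simp only [MonoidHom.pow_apply, MonoidHom.comp_apply, hg, hεA, MonoidHom.one_apply] at h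
    revert h; decide
  have hA' : A⁻¹ * E * A = E⁻¹ := by
    have e : E = A * E⁻¹ * A⁻¹ := by
      rw [← conj_inv, hAE, inv_inv]
    calc A⁻¹ * E * A = A⁻¹ * (A * E⁻¹ * A⁻¹) * A := by rw [← e]
      _ = _ := by group
  have hconj : ∀ i : ℤ, A * E ^ i * A⁻¹ = E ^ (-i) := fun i => by
    rw [← conj_zpow, hAE, inv_zpow']
  have hA4 : A⁻¹ * A⁻¹ = A * A := by
    rw [← mul_inv_rev, inv_eq_iff_mul_eq_one, ← hA]; simp only [pow_succ, pow_zero, one_mul, mul_assoc]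
  -- An odd class means `x` goes to `E^ix A` or `E^ix A⁻¹`; either inverts `E`, and the powers of
  -- `E` cancel in the square.
  have hX : R (gen n .x) * E * (R (gen n .x))⁻¹ = E⁻¹ ∧ R (gen n .x) ^ 2 = A ^ 2 := by
    have hjx : (jx : ZMod 4) = 1 ∨ (jx : ZMod 4) = -1 := by
      rw [hx, hε] at hx2; exact homology_x_unit _ hx2
    rcases hjx with h | h
    · have e : R (gen n .x) = E ^ ix * A := by
        rw [hx, zpow_eq_zpow_of_pow_four hA (j := 1) (by simpa using h), zpow_one]
      rw [e]
      constructor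
      · calc E ^ ix * A * E * (E ^ ix * A)⁻¹ = E ^ ix * (A * E * A⁻¹) * E ^ (-ix) := by group
          _ = E⁻¹ := by rw [hAE]; group
      · calc (E ^ ix * A) ^ 2 = E ^ ix * (A * E ^ ix * A⁻¹) * A ^ 2 := by
              rw [pow_two, pow_two]; group
          _ = A ^ 2 := by rw [hconj]; group
    · have e : R (gen n .x) = E ^ ix * A⁻¹ := by
        rw [hx, zpow_eq_zpow_of_pow_four hA (j := -1) (by simpa using h), zpow_neg_one]
      rw [e]
      constructor
      · calc E ^ ix * A⁻¹ * E * (E ^ ix * A⁻¹)⁻¹ = E ^ ix * (A⁻¹ * E * A) * E ^ (-ix) := by group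
          _ = E⁻¹ := by rw [hA']; group
      · have hc : A⁻¹ * E ^ ix * A = E ^ (-ix) := by
          have := conj_zpow (i := ix) (a := A⁻¹) (b := E)
          rw [inv_inv] at this
          rw [← this, hA', inv_zpow']
        calc (E ^ ix * A⁻¹) ^ 2 = E ^ ix * (A⁻¹ * E ^ ix * A) * (A⁻¹ * A⁻¹) := by
              rw [pow_two]; group
          _ = A ^ 2 := by rw [hc, hA4, pow_two]; group
  obtain ⟨hXE, hXX⟩ := hX
  have hy : (R (gen n .y))⁻¹ = R (gen n .b) ^ (2 * n + 1) * A ^ 2 := by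
    have e : (R (gen n .y))⁻¹ = R (gen n .a) ^ 2 * (R (gen n .x) ^ 2)⁻¹ := by
      rw [g4, mul_inv_cancel_right]
    rw [e, g1, hXX, pow_two A, mul_inv_rev, hA4]
  have hXF : R (gen n .x) * R (gen n .b) * (R (gen n .x))⁻¹ = (R (gen n .b))⁻¹ := by
    rw [hbE, ← conj_zpow, hXE, inv_zpow]
  -- The images of `y` and `a` are words in those of `b` and `x`, so these two generate the whole
  -- range.
  have hmem : ∀ g, R g ∈ invertingProduct hXF := by
    have hbS := left_mem_invertingProduct hXF
    have hxS := right_mem_invertingProduct hXF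
    have hyS : R (gen n .y) ∈ invertingProduct hXF := by
      rw [← inv_mem_iff, hy, ← hXX]
      exact mul_mem (zpow_mem hbS _) (pow_mem hxS _)
    have haS : R (gen n .a) ∈ invertingProduct hXF := by
      have e : R (gen n .a) = R (gen n .b) ^ n * (R (gen n .y))⁻¹ := by rw [← g3]; group
      rw [e]
      exact mul_mem (zpow_mem hbS _) (inv_mem hyS)
    intro g
    have htop : (⊤ : Subgroup (GraphGroup n)) ≤ (invertingProduct hXF).comap R := by
      rw [← PresentedGroup.closure_range_of, Subgroup.closure_le]
      rintro _ ⟨_ | _ | _ | _, rfl⟩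
      exacts [haS, hbS, hxS, hyS]
    exact htop (Subgroup.mem_top g)
  obtain ⟨g, hg⟩ := hRE
  obtain ⟨i, j, hij⟩ := hmem g
  -- Since `E` and the image of `b` have class 0, the exponent of `x` vanishes modulo 4. So `E` is a
  -- power of the image of `b`, and `ib` is a unit modulo `4n+1`.
  have hj : (j : ZMod 4) = 0 := by
    have h := congrArg (fun g => (ε g).toAdd) (hg.symm.trans hij)
    simp only [map_mul, map_zpow, toAdd_mul, toAdd_zpow, hεE, hb0, toAdd_one, smul_zero,
      zero_add, zsmul_eq_mul] at h
    exact homology_x_torsion _ _ hx2 h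
  have hX4 : R (gen n .x) ^ 4 = 1 := by
    rw [show 4 = 2 * 2 by rfl, pow_mul, hXX, ← pow_mul, hA]
  rw [hg, zpow_eq_zpow_of_pow_four hX4 (j := 0) (by simpa using hj), zpow_zero, mul_one, hbE,
    ← zpow_mul] at hij
  have hdvd : (4 * n + 1) ∣ ib * i - 1 := by
    apply hord
    rw [zpow_sub_one, ← hij, mul_inv_cancel]
  -- The inverse of `ib * (2n+1)` is `2 * i`, because `2 (2n+1) = (4n+1) + 1`.
  refine ⟨ib * (2 * n + 1), 2 * i, ?_, ?_⟩
  · rw [hμ, g3, hy, hbE, ← zpow_mul, pow_two, mul_assoc A, conj_zpow_eq_inv hAE, ← mul_assoc A,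
      conj_zpow_eq_inv hAE, neg_neg, mul_assoc]
  · obtain ⟨c, hc⟩ := hdvd
    exact ⟨c * (4 * n + 2) + 1, by linear_combination (4 * n + 2) * hc⟩

/-! ### Traces and eigenvalues in `SL(2, ℂ)` -/

/-- With determinant 1, the characteristic polynomial `X² - 2 cos θ X + 1` factors as `(X -
e^{iθ})(X - e^{-iθ})`. -/
theorem eigenvalueSet_eq_of_trace (g : SL2C) (θ : ℝ)
    (h : (g : Matrix (Fin 2) (Fin 2) ℂ).trace = 2 * (Real.cos θ : ℂ)) :
    eigenvalueSet g = {Complex.exp (θ * Complex.I), Complex.exp (-(θ * Complex.I))} := by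
  ext ξ
  have hsum : Complex.exp (θ * Complex.I) + Complex.exp (-(θ * Complex.I)) =
      2 * (Real.cos θ : ℂ) := by
    rw [Complex.ofReal_cos, Complex.two_cos, neg_mul]
  have hprod : Complex.exp (θ * Complex.I) * Complex.exp (-(θ * Complex.I)) = 1 := by
    rw [← Complex.exp_add, add_neg_cancel, Complex.exp_zero]
  simp only [eigenvalueSet, Set.mem_ofPred_eq, Set.mem_insert_iff, Set.mem_singleton_iff]
  rw [Module.End.hasEigenvalue_iff_isRoot_charpoly, Matrix.charpoly_toLin', Matrix.charpoly_fin_two,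
    h, g.det_coe, ← hsum]
  simp only [Polynomial.IsRoot.def, Polynomial.eval_add, Polynomial.eval_sub, Polynomial.eval_pow,
    Polynomial.eval_mul, Polynomial.eval_X, Polynomial.eval_C]
  rw [← sub_eq_zero (b := Complex.exp (θ * Complex.I)),
    ← sub_eq_zero (b := Complex.exp (-(θ * Complex.I))), ← mul_eq_zero, ← hprod]
  constructor <;> intro e <;> linear_combination e

theorem trace_inv (g : SL2C) : ((g⁻¹ : SL2C) : Matrix (Fin 2) (Fin 2) ℂ).trace =
    (g : Matrix (Fin 2) (Fin 2) ℂ).trace := by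
  rw [Matrix.SpecialLinearGroup.coe_inv, Matrix.adjugate_fin_two, Matrix.trace_fin_two,
    Matrix.trace_fin_two]
  simp [add_comm]

/-- Cayley–Hamilton makes `pow_formula` applicable. Taking traces there and dividing by `sin φ ≠ 0`
gives the natural powers; inversion in SL₂ preserves the trace. -/
theorem trace_zpow (g : SL2C) (φ : ℝ) (hφ : Real.sin φ ≠ 0)
    (h : (g : Matrix (Fin 2) (Fin 2) ℂ).trace = 2 * (Real.cos φ : ℂ)) (s : ℤ) :
    ((g ^ s : SL2C) : Matrix (Fin 2) (Fin 2) ℂ).trace = 2 * (Real.cos (s * φ) : ℂ) := by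
  have hnat : ∀ j : ℕ, ((g ^ j : SL2C) : Matrix (Fin 2) (Fin 2) ℂ).trace =
      2 * (Real.cos (j * φ) : ℂ) := by
    intro j
    have hsq : (g : Matrix (Fin 2) (Fin 2) ℂ) * g =
        (2 * Real.cos φ : ℂ) • (g : Matrix (Fin 2) (Fin 2) ℂ) - 1 := by
      rw [← h]
      have hd := g.det_coe
      rw [Matrix.det_fin_two] at hd
      ext i j
      fin_cases i <;> fin_cases j <;>
        simp [Matrix.mul_apply, Fin.sum_univ_two, Matrix.trace_fin_two] <;>
        first | ring1 | linear_combination -hd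
    have hp := congrArg Matrix.trace (pow_formula _ φ hsq j)
    rw [Matrix.trace_sub, Matrix.trace_smul, Matrix.trace_smul, Matrix.trace_smul, h,
      Matrix.trace_one, Fintype.card_fin] at hp
    simp only [smul_eq_mul] at hp
    have hr : Real.sin (j * φ) * (2 * Real.cos φ) - Real.sin ((j - 1) * φ) * 2 =
        Real.sin φ * (2 * Real.cos (j * φ)) := by
      rw [sub_mul, one_mul, Real.sin_sub]; ring
    have hrc := congrArg (fun r : ℝ => (r : ℂ)) hr
    push_cast at hrc hp
    have hc : (Real.sin φ : ℂ) ≠ 0 := by exact_mod_cast hφ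
    rw [Matrix.SpecialLinearGroup.coe_pow]
    apply mul_left_cancel₀ hc
    push_cast
    rw [hp, ← hrc]
  obtain ⟨j, rfl | rfl⟩ := s.eq_nat_or_neg
  · simpa using hnat j
  · rw [zpow_neg, zpow_natCast, trace_inv, hnat]
    push_cast
    rw [neg_mul, Complex.cos_neg]

theorem SL2C_neg_one_ne_one : (-1 : SL2C) ≠ 1 := by
  intro h
  have := congrArg (fun g : SL2C => (g : Matrix (Fin 2) (Fin 2) ℂ) 0 0) h
  norm_num at this

/-- `-1` is central of order 2, coprime to the odd order of `F`. -/
theorem orderOf_neg_of_odd_pow (F : SL2C) (M : ℕ) (hM : Odd M) (hF : F ^ M = 1) :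
    orderOf (-F) = 2 * orderOf F := by
  have h2 : orderOf (-1 : SL2C) = 2 :=
    orderOf_eq_prime (by simp) SL2C_neg_one_ne_one
  have hodd : Odd (orderOf F) := hM.of_dvd_nat (orderOf_dvd_of_pow_eq_one hF)
  rw [← neg_one_mul, Commute.orderOf_mul_eq_mul_orderOf_of_coprime (by simp [Commute, SemiconjBy]),
    h2]
  rw [h2]; exact (Nat.coprime_two_left).2 hodd

/-! ### Arithmetic of the indices -/

theorem not_dvd_index (n : ℤ) (k : Index n) : ¬ (4 * n + 1) ∣ (k.1 : ℤ) := by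
  obtain ⟨k, h1, h2⟩ := k
  intro h
  have := Int.natAbs_dvd_natAbs.2 h
  have := Nat.le_of_dvd (by simpa using Nat.pos_of_ne_zero (by omega)) this
  simp only [Int.natAbs_natCast] at this
  omega

/-- The indices represent the nonzero residues modulo `4n+1` up to sign: a remainder `r` beyond the
range is replaced by `|4n+1| - r`. -/
theorem exists_index (n s : ℤ) (hs : ¬ (4 * n + 1) ∣ s) :
    ∃ k : Index n, (4 * n + 1) ∣ k.1 - s ∨ (4 * n + 1) ∣ k.1 + s := by
  have hD : (4 * n + 1) ≠ 0 := by omega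
  have h0 := Int.emod_nonneg s hD
  have h1 := Int.emod_lt_abs s hD
  rw [Int.abs_eq_natAbs] at h1
  have h2 : s % (4 * n + 1) ≠ 0 := fun h => hs (Int.dvd_of_emod_eq_zero h)
  have h3 := Int.emod_add_mul_ediv s (4 * n + 1)
  generalize s % (4 * n + 1) = r at *
  by_cases hr : r.toNat ≤ ((4 * n + 1).natAbs - 1) / 2
  · exact ⟨⟨r.toNat, by omega, hr⟩, Or.inl ⟨-(s / (4 * n + 1)), by
      rw [Int.toNat_of_nonneg h0]; linear_combination h3⟩⟩
  · refine ⟨⟨(4 * n + 1).natAbs - r.toNat, by omega, by omega⟩, Or.inr ?_⟩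
    have e : (((4 * n + 1).natAbs - r.toNat : ℕ) : ℤ) = ((4 * n + 1).natAbs : ℤ) - r := by omega
    rw [e]
    have : ((4 * n + 1).natAbs : ℤ) - r + s =
        ((4 * n + 1).natAbs : ℤ) + (4 * n + 1) * (s / (4 * n + 1)) := by
      linear_combination -h3
    rw [this]
    exact dvd_add (Int.dvd_natAbs.2 dvd_rfl) (dvd_mul_right _ _)

/-- The substitution gives `2j - 1 = |4n+1| - 2t` with `t ≡ ±lk`, so the two angles agree up to sign
modulo `2π`. -/
theorem cos_eq_cos_of_index (n l : ℤ) (k j t : Index n)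
    (hj : (j.1 : ℤ) = ((4 * n + 1).natAbs + 1) / 2 - t.1)
    (h : (4 * n + 1) ∣ t.1 - l * k.1 ∨ (4 * n + 1) ∣ t.1 + l * k.1) :
    Real.cos (π - l * (2 * (k.1 * π / (4 * (n : ℝ) + 1)))) =
      Real.cos (π * (2 * (j.1 : ℝ) - 1) / |4 * (n : ℝ) + 1|) := by
  have hD : (4 * (n : ℝ) + 1) ≠ 0 := by exact_mod_cast (by omega : (4 * n + 1) ≠ 0)
  have habs : Real.cos (π * (2 * (j.1 : ℝ) - 1) / |4 * (n : ℝ) + 1|) =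
      Real.cos (π * (2 * (j.1 : ℝ) - 1) / (4 * (n : ℝ) + 1)) := by
    rcases abs_choice (4 * (n : ℝ) + 1) with h | h
    · rw [h]
    · rw [h, div_neg, Real.cos_neg]
  rw [habs, Real.cos_eq_cos_iff]
  have hint : ∃ c : ℤ, (2 * (j.1 : ℤ) - 1 = 2 * c * (4 * n + 1) + ((4 * n + 1) - 2 * l * k.1)) ∨
      (2 * (j.1 : ℤ) - 1 = 2 * c * (4 * n + 1) - ((4 * n + 1) - 2 * l * k.1)) := by
    have hM : (2 * (j.1 : ℤ) - 1 = (4 * n + 1) - 2 * t.1) ∨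
        (2 * (j.1 : ℤ) - 1 = -(4 * n + 1) - 2 * t.1) := by omega
    rcases hM with hM | hM <;> rcases h with ⟨c, hc⟩ | ⟨c, hc⟩
    · exact ⟨-c, Or.inl (by linear_combination hM - 2 * hc)⟩
    · exact ⟨1 - c, Or.inr (by linear_combination hM - 2 * hc)⟩
    · exact ⟨-1 - c, Or.inl (by linear_combination hM - 2 * hc)⟩
    · exact ⟨-c, Or.inr (by linear_combination hM - 2 * hc)⟩
  obtain ⟨c, hc | hc⟩ := hint
  · refine ⟨c, Or.inl ?_⟩
    have hc' : (2 * (j.1 : ℝ) - 1 = 2 * c * (4 * n + 1) + ((4 * n + 1) - 2 * l * k.1)) := by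
      exact_mod_cast hc
    rw [hc']; field_simp
  · refine ⟨c, Or.inr ?_⟩
    have hc' : (2 * (j.1 : ℝ) - 1 = 2 * c * (4 * n + 1) - ((4 * n + 1) - 2 * l * k.1)) := by
      exact_mod_cast hc
    rw [hc']; field_simp

/-! ### The representations `ρ_k` -/

/-- The half angle `kπ/(4n+1)`. -/
noncomputable def halfAngle (n : ℤ) (k : Index n) : ℝ := k.1 * π / (4 * (n : ℝ) + 1)

theorem u_eq (n : ℤ) (k : Index n) : u n k = -2 + 2 * Real.cos (2 * halfAngle n k) := by
  rw [Real.cos_two_mul, Real.cos_sq', u, halfAngle]; ring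

theorem sin_ne_zero (n : ℤ) (k : Index n) : Real.sin (2 * halfAngle n k) ≠ 0 := by
  intro h
  obtain ⟨c, hc⟩ := Real.sin_eq_zero_iff.1 h
  have hD : (4 * (n : ℝ) + 1) ≠ 0 := by exact_mod_cast (by omega : (4 * n + 1) ≠ 0)
  rw [halfAngle] at hc
  field_simp at hc
  have hc' : c * (4 * n + 1) = 2 * (k.1 : ℤ) := by
    have := Real.pi_pos.ne'
    exact_mod_cast (show (c : ℝ) * (4 * n + 1) = 2 * k.1 by linarith)
  have hdvd : (4 * n + 1) ∣ 2 * (k.1 : ℤ) := ⟨c, by rw [← hc', mul_comm]⟩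
  -- 2 is invertible modulo `4n+1`: `(4n+1) - 2n·2 = 1`.
  exact not_dvd_index n k (IsCoprime.dvd_of_dvd_mul_left ⟨1, -2 * n, by ring⟩ hdvd)

theorem u_ne_zero (n : ℤ) (k : Index n) : u n k ≠ 0 := by
  intro h
  apply sin_ne_zero n k
  rw [u] at h
  have : Real.sin (halfAngle n k) = 0 := pow_eq_zero_iff two_ne_zero |>.1 (by
    rw [halfAngle]; linarith)
  rw [Real.sin_two_mul, this]
  ring

/-- The values 0 and `-4` of `u` are the ones at which the irreducibility argument would break down.
-/
theorem u_ne_neg_four (n : ℤ) (k : Index n) : u n k ≠ -4 := by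
  intro h
  apply sin_ne_zero n k
  rw [u, Real.sin_sq] at h
  have : Real.cos (halfAngle n k) = 0 := pow_eq_zero_iff two_ne_zero |>.1 (by
    rw [halfAngle]; linarith)
  rw [Real.sin_two_mul, this]
  ring

/-- The matrix `ρ_k(β α⁻¹)`. -/
noncomputable def matE (n : ℤ) (k : Index n) : SL2C := matB n k * matA⁻¹

theorem matA_inv : matA⁻¹ = -matA := by
  rw [inv_eq_iff_mul_eq_one, mul_neg, matA_sq, neg_neg]

theorem matB_inv (n : ℤ) (k : Index n) : (matB n k)⁻¹ = -matB n k := by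
  rw [inv_eq_iff_mul_eq_one, mul_neg, matB_sq, neg_neg]

/-- As `A² = B² = -1`, both sides equal `-AB`. -/
theorem matE_conj (n : ℤ) (k : Index n) : matA * matE n k * matA⁻¹ = (matE n k)⁻¹ := by
  rw [matE, mul_inv_rev, inv_inv, matB_inv, mul_assoc, mul_assoc, matA_inv, neg_mul_neg, matA_sq]
  simp

theorem matE_zpow (n : ℤ) (k : Index n) : matE n k ^ (4 * n + 1) = 1 := by
  have hodd : Odd (4 * n + 1) := ⟨2 * n, by ring⟩
  have h1 : (-1 : SL2C) ^ (4 * n + 1) = -1 := by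
    rw [zpow_add_one, show 4 * n = 2 * (2 * n) by ring, zpow_mul]
    simp
  rw [matE, matA_inv, mul_neg, ← neg_one_mul, Commute.mul_zpow (by simp [Commute, SemiconjBy]),
    C_zpow, h1]
  simp

theorem matE_trace (n : ℤ) (k : Index n) :
    (matE n k : Matrix (Fin 2) (Fin 2) ℂ).trace = 2 * (Real.cos (2 * halfAngle n k) : ℂ) := by
  have hu : (u n k : ℂ) = -2 + 2 * (Real.cos (2 * halfAngle n k) : ℂ) := by
    rw [u_eq]; push_cast; ring
  rw [matE, matA_inv, mul_neg, Matrix.SpecialLinearGroup.coe_neg,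
    Matrix.SpecialLinearGroup.coe_mul, Matrix.trace_fin_two]
  simp [matA, matB, mul_assoc, hu]
  ring

theorem matE_zpow_trace (n : ℤ) (k : Index n) (s : ℤ) :
    ((matE n k ^ s : SL2C) : Matrix (Fin 2) (Fin 2) ℂ).trace =
      2 * (Real.cos (s * (2 * halfAngle n k)) : ℂ) :=
  trace_zpow _ _ (sin_ne_zero n k) (matE_trace n k) s

theorem rho_word_alpha (n : ℤ) (k : Index n) : rho n k (word n fα) = matA :=
  PresentedGroup.toGroup.of _

theorem rho_word_beta (n : ℤ) (k : Index n) : rho n k (word n fβ) = matB n k :=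
  PresentedGroup.toGroup.of _

theorem rho_irreducible (n : ℤ) (k : Index n) : IsIrreducibleRep (rho n k) := by
  intro W hW
  by_cases hbot : W = ⊥
  · exact Or.inl hbot
  right
  obtain ⟨v, hv, hv0⟩ := W.exists_mem_ne_zero_of_ne_bot hbot
  have hA : ∀ v ∈ W, (matA : Matrix (Fin 2) (Fin 2) ℂ) *ᵥ v ∈ W := fun v hv => by
    simpa only [rho_word_alpha] using hW (word n fα) v hv
  have hB : ∀ v ∈ W, (matB n k : Matrix (Fin 2) (Fin 2) ℂ) *ᵥ v ∈ W := fun v hv => by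
    simpa only [rho_word_beta] using hW (word n fβ) v hv
  have hAv : ∀ w, (matA : Matrix (Fin 2) (Fin 2) ℂ) *ᵥ w =
      ![Complex.I * w 0 - Complex.I * w 1, -Complex.I * w 1] := fun w => by
    ext i; fin_cases i <;> simp [matA, Matrix.mulVec, dotProduct, Fin.sum_univ_two] <;> ring
  have hBv : ∀ w, (matB n k : Matrix (Fin 2) (Fin 2) ℂ) *ᵥ w =
      ![Complex.I * w 0, -(u n k : ℂ) * Complex.I * w 0 - Complex.I * w 1] := fun w => by
    ext i; fin_cases i <;> simp [matB, Matrix.mulVec, dotProduct, Fin.sum_univ_two] <;> ring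
  have hu : (u n k : ℂ) ≠ 0 := by exact_mod_cast u_ne_zero n k
  have hu4 : (u n k : ℂ) + 4 ≠ 0 := by
    intro h
    apply u_ne_neg_four n k
    have h' : (u n k : ℂ) = -4 := by linear_combination h
    exact_mod_cast h'
  have hI := Complex.I_ne_zero
  have hspan : ![1, 0] ∈ W → ![0, 1] ∈ W → W = ⊤ := by
    intro h0 h1
    rw [Submodule.eq_top_iff']
    intro w
    have e : w = w 0 • ![1, 0] + w 1 • ![0, 1] := by
      ext i; fin_cases i <;> simp
    rw [e]
    exact W.add_mem (W.smul_mem _ h0) (W.smul_mem _ h1)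
  by_cases h1 : v 1 = 0
  · have h00 : v 0 ≠ 0 := by
      intro h0
      apply hv0
      ext i; fin_cases i <;> simp [h0, h1]
    have e0 : ![1, 0] ∈ W := by
      have : (![1, 0] : Fin 2 → ℂ) = (v 0)⁻¹ • v := by
        ext i; fin_cases i <;> simp [h1, h00]
      rw [this]; exact W.smul_mem _ hv
    refine hspan e0 ?_
    have : (![0, 1] : Fin 2 → ℂ) = (-(u n k : ℂ) * Complex.I)⁻¹ •
        ((matB n k : Matrix (Fin 2) (Fin 2) ℂ) *ᵥ ![1, 0] - Complex.I • ![1, 0]) := by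
      rw [hBv, eq_inv_smul_iff₀ (by simp [hu])]
      ext i; fin_cases i <;> simp
    rw [this]
    exact W.smul_mem _ (W.sub_mem (hB _ e0) (W.smul_mem _ e0))
  -- `(A - i) v` is a multiple of `(1, 2)`, the eigenvector of `A` for `-i`; then `(B - i)(1, 2) =
  -- (0, -(u + 4) i)`.
  · have e12 : ![1, 2] ∈ W := by
      have : (![1, 2] : Fin 2 → ℂ) = (-Complex.I * v 1)⁻¹ •
          ((matA : Matrix (Fin 2) (Fin 2) ℂ) *ᵥ v - Complex.I • v) := by
        rw [hAv, eq_inv_smul_iff₀ (by simp [h1])]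
        ext i; fin_cases i <;> simp <;> ring
      rw [this]
      exact W.smul_mem _ (W.sub_mem (hA _ hv) (W.smul_mem _ hv))
    have e1 : ![0, 1] ∈ W := by
      have : (![0, 1] : Fin 2 → ℂ) = (-((u n k : ℂ) + 4) * Complex.I)⁻¹ •
          ((matB n k : Matrix (Fin 2) (Fin 2) ℂ) *ᵥ ![1, 2] - Complex.I • ![1, 2]) := by
        rw [hBv, eq_inv_smul_iff₀ (mul_ne_zero (neg_ne_zero.2 hu4) hI)]
        ext i; fin_cases i <;> simp <;> ring
      rw [this]
      exact W.smul_mem _ (W.sub_mem (hB _ e12) (W.smul_mem _ e12))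
    refine hspan ?_ e1
    have : (![1, 0] : Fin 2 → ℂ) = ![1, 2] - (2 : ℂ) • ![0, 1] := by
      ext i; fin_cases i <;> simp
    rw [this]
    exact W.sub_mem e12 (W.smul_mem _ e1)

/-! ### All the representations `ρ̄_k` together, with the homology class -/

/-- The product of the targets of the `ρ̄_k` and of the homology group `ℤ/4`. -/
abbrev Target (n : ℤ) : Type := (Index n → SL2C) × Multiplicative (ZMod 4)

/-- The image of `α` in the product. -/
noncomputable def totalA (n : ℤ) : Target n := (fun _ => matA, Multiplicative.ofAdd 1)

/-- The image of `β α⁻¹` in the product. -/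
noncomputable def totalE (n : ℤ) : Target n := (fun k => matE n k, 1)

theorem totalA_conj (n : ℤ) : totalA n * totalE n * (totalA n)⁻¹ = (totalE n)⁻¹ :=
  Prod.ext (funext fun k => matE_conj n k) rfl

theorem totalA_pow_four (n : ℤ) : totalA n ^ 4 = 1 := by
  refine Prod.ext (funext fun k => ?_)
    (by decide : (Multiplicative.ofAdd (1 : ZMod 4)) ^ 4 = 1)
  change matA ^ 4 = 1
  rw [show 4 = 2 * 2 by rfl, pow_mul, pow_two matA, matA_sq]
  simp

/-- The component `k = 1`, available because `n ≠ 0`, already detects the full order: its `s`-th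
power has trace `2 cos(2πs/(4n+1))`, which is 2 only if `4n+1` divides `s`. -/
theorem dvd_of_totalE_zpow (n : ℤ) (hn : n ≠ 0) (s : ℤ) (h : totalE n ^ s = 1) :
    (4 * n + 1) ∣ s := by
  set k : Index n := ⟨1, le_rfl, by omega⟩ with hk
  have hks : matE n k ^ s = 1 := congrFun (congrArg Prod.fst h) k
  have ht := matE_zpow_trace n k s
  rw [hks, Matrix.SpecialLinearGroup.coe_one, Matrix.trace_one, Fintype.card_fin] at ht
  have hc : Real.cos (s * (2 * halfAngle n k)) = 1 := by
    have : (Real.cos (s * (2 * halfAngle n k)) : ℂ) = 1 := by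
      push_cast at ht ⊢; linear_combination -ht / 2
    exact_mod_cast this
  obtain ⟨c, hc⟩ := (Real.cos_eq_one_iff _).1 hc
  have hD : (4 * (n : ℝ) + 1) ≠ 0 := by exact_mod_cast (by omega : (4 * n + 1) ≠ 0)
  have hπ := Real.pi_pos.ne'
  rw [halfAngle, hk] at hc
  push_cast at hc
  field_simp at hc
  exact ⟨c, by
    have : (s : ℝ) = (4 * n + 1) * c := by linarith
    exact_mod_cast this⟩

theorem exists_total (n : ℤ) : ∃ T : SurgeryGroup n →* Target n,
    (∀ g k, (T g).1 k = rhoBar n k g) ∧ T (sα n) = totalA n ∧ T (sβ n) = totalE n * totalA n := by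
  obtain ⟨ε, hα, hβ⟩ := SurgeryGroup.exists_hom n (Multiplicative.ofAdd (1 : ZMod 4))
    (Multiplicative.ofAdd (1 : ZMod 4)) (by group) (by
      have h1 : (Multiplicative.ofAdd (1 : ZMod 4)) ^ 4 = 1 := by decide
      rw [h1]; group)
  refine ⟨(MonoidHom.pi fun k => rhoBar n k).prod ε, fun _ _ => rfl, ?_, ?_⟩
  · exact Prod.ext (funext fun k => rho_word_alpha n k) hα
  · refine Prod.ext (funext fun k => ?_) ?_
    · change rho n k (word n fβ) = matE n k * matA
      rw [rho_word_beta, matE, inv_mul_cancel_right]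
    · change ε (sβ n) = 1 * Multiplicative.ofAdd 1
      rw [hβ, one_mul]

theorem total_mem (n : ℤ) (T : SurgeryGroup n →* Target n) (hα : T (sα n) = totalA n)
    (hβ : T (sβ n) = totalE n * totalA n) (g : SurgeryGroup n) :
    T g ∈ invertingProduct (totalA_conj n) := by
  obtain ⟨g, rfl⟩ := QuotientGroup.mk_surjective g
  have htop : (⊤ : Subgroup (KnotGroup n)) ≤
      (invertingProduct (totalA_conj n)).comap (T.comp (QuotientGroup.mk' _)) := by
    rw [← PresentedGroup.closure_range_of, Subgroup.closure_le]
    rintro _ ⟨_ | _, rfl⟩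
    · change T (sα n) ∈ invertingProduct (totalA_conj n)
      rw [hα]; exact right_mem_invertingProduct _
    · change T (sβ n) ∈ invertingProduct (totalA_conj n)
      rw [hβ]
      exact mul_mem (left_mem_invertingProduct _) (right_mem_invertingProduct _)
  exact htop (Subgroup.mem_top g)

/-- A commutator has trivial class in ℤ/4, so its total image `E^i A^j` has `4 ∣ j` and reduces to a
power of `E`. -/
theorem rho_metabelian (n : ℤ) (k : Index n) : IsMetabelianRep (rho n k) := by
  obtain ⟨T, hT, hα, hβ⟩ := exists_total n
  have key : ∀ g ∈ commutator (KnotGroup n), ∃ i : ℤ, rho n k g = matE n k ^ i := by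
    intro g hg
    obtain ⟨i, j, hij⟩ := total_mem n T hα hβ (QuotientGroup.mk g)
    have h1 : (T (QuotientGroup.mk g)).2 = 1 :=
      Abelianization.commutator_subset_ker
        (((MonoidHom.snd _ _).comp T).comp (QuotientGroup.mk' _)) hg
    have hj : (j : ZMod 4) = 0 := by
      have := congrArg (fun t : Target n => t.2.toAdd) hij
      simp only [h1] at this
      simpa [totalE, totalA] using this.symm
    rw [zpow_eq_zpow_of_pow_four (totalA_pow_four n) (j := 0) (by simpa using hj), zpow_zero,
      mul_one] at hij
    refine ⟨i, ?_⟩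
    change rhoBar n k (QuotientGroup.mk g) = _
    rw [← hT, hij]; rfl
  intro g hg h hh
  obtain ⟨i, hi⟩ := key g hg
  obtain ⟨j, hj⟩ := key h hh
  rw [hi, hj, ← zpow_add, ← zpow_add, add_comm]

theorem exists_rhoBar_torusMeridian (n : ℤ) (hn : n ≠ 0) (φ : GraphGroup n ≃* SurgeryGroup n) :
    ∃ l i : ℤ, (∀ k, rhoBar n k (φ (torusMeridian n)) = -(matE n k ^ l)) ∧
      (4 * n + 1) ∣ l * i - 1 := by
  obtain ⟨T, hT, hα, hβ⟩ := exists_total n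
  obtain ⟨l, i, hl, hi⟩ := exists_map_torusMeridian n (totalA_conj n) (totalA_pow_four n)
    (dvd_of_totalE_zpow n hn) (MonoidHom.snd _ _) rfl rfl (T.comp φ.toMonoidHom)
    (fun g => total_mem n T hα hβ _) ⟨φ.symm (sα n), by simp [hα]⟩
    ⟨φ.symm (sβ n * (sα n)⁻¹), by simp [hα, hβ]⟩
  refine ⟨l, i, fun k => ?_, hi⟩
  rw [← hT]
  refine (congrFun (congrArg Prod.fst hl) k).trans ?_
  change matA ^ 2 * matE n k ^ l = _
  rw [pow_two, matA_sq, neg_one_mul]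

end TwistKnot

/-! ### Eigenvalue pairs and orders for an arbitrary identification -/

open TwistKnot in
theorem proposition3p6 (n : ℤ) (hn₀ : n ≠ 0) (hn₁ : n ≠ -1) :
    Nonempty (GraphGroup n ≃* SurgeryGroup n) ∧
    (∀ k : Index n, IsIrreducibleRep (rho n k) ∧ IsMetabelianRep (rho n k)) ∧
    ∀ φ : GraphGroup n ≃* SurgeryGroup n,
      Set.range (fun k : Index n => eigenvalueSet (rhoBar n k (φ (torusMeridian n)))) =
        Set.range (fun j : Index n =>
          ({Complex.exp ((π * (2 * (j.1 : ℝ) - 1) / |4 * (n : ℝ) + 1| : ℝ) * Complex.I),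
            Complex.exp (-((π * (2 * (j.1 : ℝ) - 1) / |4 * (n : ℝ) + 1| : ℝ) * Complex.I))} :
              Set ℂ)) ∧
      ∀ k : Index n, ∃ p : ℕ, p ∣ (4 * n + 1).natAbs ∧
        orderOf (rhoBar n k (φ (torusMeridian n))) = 2 * p := by
  refine ⟨nonempty_graphGroup_mulEquiv_surgeryGroup n,
    fun k => ⟨rho_irreducible n k, rho_metabelian n k⟩, fun φ => ?_⟩
  obtain ⟨l, i, hl, hi⟩ := exists_rhoBar_torusMeridian n hn₀ φ
  have hset : ∀ k j t : Index n, (j.1 : ℤ) = ((4 * n + 1).natAbs + 1) / 2 - t.1 →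
      ((4 * n + 1) ∣ t.1 - l * k.1 ∨ (4 * n + 1) ∣ t.1 + l * k.1) →
      eigenvalueSet (rhoBar n k (φ (torusMeridian n))) =
        {Complex.exp ((π * (2 * (j.1 : ℝ) - 1) / |4 * (n : ℝ) + 1| : ℝ) * Complex.I),
          Complex.exp (-((π * (2 * (j.1 : ℝ) - 1) / |4 * (n : ℝ) + 1| : ℝ) * Complex.I))} := by
    intro k j t hj h
    apply eigenvalueSet_eq_of_trace
    rw [hl, Matrix.SpecialLinearGroup.coe_neg, Matrix.trace_neg, matE_zpow_trace,
      ← cos_eq_cos_of_index n l k j t hj h, Real.cos_pi_sub, halfAngle]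
    push_cast; ring
  constructor
  · apply Set.Subset.antisymm
    · rintro _ ⟨k, rfl⟩
      have hk : ¬ (4 * n + 1) ∣ l * k.1 := by
        intro h
        apply not_dvd_index n k
        have h2 := dvd_sub (h.mul_left i) (hi.mul_left (k.1 : ℤ))
        rwa [show i * (l * k.1) - k.1 * (l * i - 1) = (k.1 : ℤ) by ring] at h2
      obtain ⟨t, ht⟩ := exists_index n _ hk
      obtain ⟨ht1, ht2⟩ := t.2
      -- The involution `t ↦ (|4n+1|+1)/2 - t` of the index range accounts for the sign in `-E_k^l`.
      exact ⟨⟨((4 * n + 1).natAbs + 1) / 2 - t.1, by omega, by omega⟩,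
        (hset k _ t (by dsimp only; omega) ht).symm⟩
    · rintro _ ⟨j, rfl⟩
      obtain ⟨hj1, hj2⟩ := j.2
      set t : Index n := ⟨((4 * n + 1).natAbs + 1) / 2 - j.1, by omega, by omega⟩ with htdef
      have htv : (t.1 : ℤ) = ((4 * n + 1).natAbs + 1) / 2 - j.1 := by
        rw [htdef]; dsimp only; omega
      have hit : ¬ (4 * n + 1) ∣ i * t.1 := by
        intro h
        apply not_dvd_index n t
        have h2 := dvd_sub (h.mul_left l) (hi.mul_left (t.1 : ℤ))
        rwa [show l * (i * t.1) - t.1 * (l * i - 1) = (t.1 : ℤ) by ring] at h2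
      -- Inverting `t ≡ ±lk` requires `k ≡ ±it`, as `l * i ≡ 1` modulo `4n+1`.
      obtain ⟨k, hk⟩ := exists_index n _ hit
      refine ⟨k, hset k j t (by omega) ?_⟩
      rcases hk with h | h
      · left
        have h2 := dvd_sub ((h.mul_left l).neg_right) (hi.mul_left (t.1 : ℤ))
        rwa [show -(l * (k.1 - i * t.1)) - t.1 * (l * i - 1) = (t.1 : ℤ) - l * k.1 by ring] at h2
      · right
        have h2 := dvd_sub (h.mul_left l) (hi.mul_left (t.1 : ℤ))
        rwa [show l * (k.1 + i * t.1) - t.1 * (l * i - 1) = (t.1 : ℤ) + l * k.1 by ring] at h2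
  · intro k
    have hpow : (matE n k ^ l) ^ (4 * n + 1).natAbs = 1 := by
      rw [pow_natAbs_eq_one, ← zpow_mul, mul_comm, zpow_mul, matE_zpow, one_zpow]
    refine ⟨orderOf (matE n k ^ l), orderOf_dvd_of_pow_eq_one hpow, ?_⟩
    rw [hl]
    exact orderOf_neg_of_odd_pow _ _ (by rw [Int.natAbs_odd]; exact ⟨2 * n, by ring⟩) hpow
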